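/- Let $I$ be a finite undirected graph on $n$ vertices (parallel edges and loops allowed) with a conductance $c_e>0$ on every edge $e$. For vertices $s,t$, the effective resistance $\mathrm{Reff}_I(s,t)$ is the minimum of the energy $\sum_{e} g_e^2/c_e$ over all flows $g$ that send one unit from $s$ to $t$ (and $\infty$ if there is no such flow). The random walk in $I$ repeatedly chooses one of the edges incident with its current vertex, with probability proportional to its conductance, and traverses it. There is an absolute constant $C>0$ with the following property. Consider the (infinite) random walk $X_0,X_1,X_2,\dots$ in $I$ started at an arbitrary vertex $X_0=x_0$, an edge $f$ of $I$ with ends $u$ and $v$, a set $S$ of vertices of $I$, and a real number $R\ge 0$. Let $K$ be the number of times $t\ge 0$ at which the walk traverses $f$ from $X_t=u$ to $X_{t+1}=v$ and at which some vertex $s\in S\setminus\{X_0,\dots,X_t\}$ satisfies $\mathrm{Reff}_I(u,s)\le R$. Then $$\mathbf{E}[K]\;\le\; C\,\log(n)\, c_f\, R ;$$ in particular, $\mathbf{E}[K]=\tilde O(c_f R)$. -/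

import Mathlib

open MeasureTheory
open scoped ENNReal

/-- A finite undirected graph on vertex set `V` with edge set `E` and positive conductances on its
edges. Parallel edges and loops are allowed. `src` and `tgt` are the two ends of an edge, listed in
an arbitrary order: it only serves as the reference orientation for the sign of a flow. -/
structure WeightedGraph (V E : Type*) where
  src : E → V
  tgt : E → V
  c : E → ℝ
  c_pos : ∀ e, 0 < c e

namespace WeightedGraph

variable {V E : Type*}

/-- `e` is an edge with ends `x` and `y` (it can be traversed from `x` to `y`). -/
def Joins (G : WeightedGraph V E) (e : E) (x y : V) : Prop :=
  (G.src e = x ∧ G.tgt e = y) ∨ (G.src e = y ∧ G.tgt e = x)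

open Classical in
/-- Total conductance of the edges incident with `x`. -/
noncomputable def deg [Fintype E] (G : WeightedGraph V E) (x : V) : ℝ :=
  ∑ e with G.src e = x ∨ G.tgt e = x, G.c e

open Classical in
/-- Probability that a walk step from `x` uses the edge `e` and leads to `y`: an edge incident
with `x` is chosen with probability proportional to its conductance. -/
noncomputable def stepProb [Fintype E] (G : WeightedGraph V E) (x : V) (e : E) (y : V) : ℝ :=
  if G.Joins e x y then G.c e / G.deg x else 0

open Classical in
/-- `g` sends one unit of flow from `s` to `t`; `g e` is the flow on `e` from `src e` to `tgt e`. -/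
def IsUnitFlow [Fintype E] (G : WeightedGraph V E) (s t : V) (g : E → ℝ) : Prop :=
  ∀ x, (∑ e with G.src e = x, g e) - (∑ e with G.tgt e = x, g e)
    = (if x = s then 1 else 0) - (if x = t then 1 else 0)

/-- The energy of a flow; the resistance of `e` is `1 / c e`. -/
noncomputable def energy [Fintype E] (G : WeightedGraph V E) (g : E → ℝ) : ℝ :=
  ∑ e, g e ^ 2 / G.c e

/-- Effective resistance: the least energy of a unit flow from `s` to `t`. It is `∞` if there is
no such flow, that is, if `s` and `t` lie in different components. -/
noncomputable def reff [Fintype E] (G : WeightedGraph V E) (s t : V) : ℝ≥0∞ :=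
  ⨅ (g : E → ℝ) (_ : G.IsUnitFlow s t g), ENNReal.ofReal (G.energy g)

/-- `X` (visited vertices) and `Y` (traversed edges) form a random walk in `G` started at `x₀`:
`Y t` is the edge traversed in the step from `X t` to `X (t + 1)`. -/
structure IsRandomWalk [Fintype E] (G : WeightedGraph V E) {Ω : Type*} [MeasurableSpace Ω]
    (P : Measure Ω) (x₀ : V) (X : ℕ → Ω → V) (Y : ℕ → Ω → E) : Prop where
  isProbabilityMeasure : IsProbabilityMeasure P
  measurableSet_vertex : ∀ t x, MeasurableSet {ω | X t ω = x}
  measurableSet_edge : ∀ t e, MeasurableSet {ω | Y t ω = e}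
  start : ∀ᵐ ω ∂P, X 0 ω = x₀
  step : ∀ (t : ℕ) (x : ℕ → V) (e : ℕ → E),
    P {ω | (∀ i ≤ t + 1, X i ω = x i) ∧ ∀ i ≤ t, Y i ω = e i}
      = P {ω | (∀ i ≤ t, X i ω = x i) ∧ ∀ i < t, Y i ω = e i}
        * ENNReal.ofReal (G.stepProb (x t) (e t) (x (t + 1)))

/-- The set of outcomes in which step `t` traverses `f` from `u` to `v` while `u` is within
effective resistance `R` of some vertex of `S` that was not visited up to time `t`. -/
def traversalEvent [Fintype E] (G : WeightedGraph V E) {Ω : Type*}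
    (X : ℕ → Ω → V) (Y : ℕ → Ω → E) (f : E) (u v : V) (S : Set V) (R : ℝ) (t : ℕ) : Set Ω :=
  {ω | X t ω = u ∧ Y t ω = f ∧ X (t + 1) ω = v ∧
    ∃ s ∈ S, (∀ i ≤ t, X i ω ≠ s) ∧ G.reff u s ≤ ENNReal.ofReal R}

open Classical in
/-- The (possibly infinite) number of such traversals over the whole infinite walk. -/
noncomputable def traversalCount [Fintype E] (G : WeightedGraph V E) {Ω : Type*}
    (X : ℕ → Ω → V) (Y : ℕ → Ω → E) (f : E) (u v : V) (S : Set V) (R : ℝ) (ω : Ω) : ℝ≥0∞ :=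
  ∑' t : ℕ, if ω ∈ G.traversalEvent X Y f u v S R t then 1 else 0

end WeightedGraph

/-!
For every target `s` within effective resistance `R` of `u`, let `φ s` be the voltage of a unit
battery, `1` at `u` and `0` at `s`. It is superharmonic off `s`, and by the Dirichlet principle the
current out of `u` is at least `1 / R`. The process `log (1 + ∑ φ s (X t))`, where `s` runs over the
targets not visited up to time `t`, is then a supermartingale: a concave increasing function of a
superharmonic one, for which dropping a target at the moment it is visited costs nothing, since its
voltage is `0` there. It starts at most at `log n` and stays nonnegative. At a visit to `u` with
`k ≥ 1` targets left, the sum equals `k` and its expected decrease is at least `k / (R * deg u)`, so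
the logarithm decreases in expectation by at least `(k / (1 + k)) / (R * deg u)`, hence by
`1 / (2 * R * deg u)`. The expected number of such visits is therefore at most
`2 * R * deg u * log n`, and each of them continues through `f` with probability `c f / deg u`.
-/

section FiniteRange

variable {Ω ι : Type*} [MeasurableSpace Ω] {Z : Ω → ι}

theorem measurableSet_preimage_of_fiber [Countable ι]
    (hZ : ∀ i, MeasurableSet (Z ⁻¹' {i})) (s : Set ι) : MeasurableSet (Z ⁻¹' s) := by
  rw [← Set.biUnion_preimage_singleton]
  exact .biUnion s.to_countable fun i _ => hZ i

variable {B : Type*} [NormedAddCommGroup B] {P : Measure Ω} [IsFiniteMeasure P]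

theorem integrable_comp_of_fiber [Finite ι] (hZ : ∀ i, MeasurableSet (Z ⁻¹' {i})) (F : ι → B) :
    Integrable (fun ω => F (Z ω)) P := by
  let _ : MeasurableSpace ι := ⊤
  exact (Integrable.of_finite (μ := P.map Z)).comp_measurable
    fun s _ => measurableSet_preimage_of_fiber hZ s

theorem integral_comp_of_fiber [Fintype ι] [NormedSpace ℝ B] [CompleteSpace B]
    (hZ : ∀ i, MeasurableSet (Z ⁻¹' {i})) (F : ι → B) :
    ∫ ω, F (Z ω) ∂P = ∑ i, P.real (Z ⁻¹' {i}) • F i := by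
  let _ : MeasurableSpace ι := ⊤
  have hmeas : Measurable Z := fun s _ => measurableSet_preimage_of_fiber hZ s
  rw [← integral_map_of_stronglyMeasurable hmeas .of_discrete, integral_fintype .of_finite]
  simp_rw [map_measureReal_apply hmeas (measurableSet_singleton _)]

end FiniteRange

namespace WeightedGraph

section UnitPotentials

variable {V : Type*} {u s : V}

/-- The potentials with values in `[0, 1]` that are `1` at `u` and `0` at `s`, among which the
voltage minimizes the Dirichlet energy. -/
def unitPotentials (u s : V) : Set (V → ℝ) :=
  Set.Icc 0 1 ∩ ({φ | φ u = 1} ∩ {φ | φ s = 0})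

theorem isCompact_unitPotentials (u s : V) : IsCompact (unitPotentials u s) :=
  isCompact_Icc.inter_right ((isClosed_eq (continuous_apply u) continuous_const).inter
    (isClosed_eq (continuous_apply s) continuous_const))

theorem convex_unitPotentials (u s : V) : Convex ℝ (unitPotentials u s) :=
  (convex_Icc 0 1).inter ((convex_hyperplane (LinearMap.proj u).isLinear 1).inter
    (convex_hyperplane (LinearMap.proj s).isLinear 0))

variable [DecidableEq V]

theorem single_mem_unitPotentials (hsu : s ≠ u) : Pi.single u 1 ∈ unitPotentials u s :=
  ⟨⟨Pi.single_nonneg.2 zero_le_one, fun x => by by_cases hx : x = u <;> simp [hx]⟩,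
    Pi.single_eq_same u 1, Pi.single_eq_of_ne hsu 1⟩

theorem update_one_mem_unitPotentials {φ : V → ℝ} (hφ : φ ∈ unitPotentials u s) {x : V}
    (hx : x ≠ s) : Function.update φ x 1 ∈ unitPotentials u s := by
  obtain ⟨⟨h0, h1⟩, hu, hs⟩ := hφ
  refine ⟨⟨le_update_iff.2 ⟨zero_le_one, fun y _ => h0 y⟩,
    update_le_iff.2 ⟨le_rfl, fun y _ => h1 y⟩⟩, ?_, ?_⟩
  · simpa [Function.update_apply] using fun _ => hu
  · simpa [Function.update_of_ne hx.symm] using hs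

end UnitPotentials

section PotentialTheory

variable {V E : Type*} [Fintype E] (G : WeightedGraph V E)

open Classical in
/-- The total conductance between `x` and `y`, which turns the multigraph into a symmetric
weight on pairs of vertices. -/
noncomputable def conductance (x y : V) : ℝ :=
  ∑ e with G.Joins e x y, G.c e

/-- The Dirichlet energy of a potential, i.e. the energy of the current that it induces. -/
noncomputable def dirichlet (φ : V → ℝ) : ℝ :=
  ∑ e, G.c e * (φ (G.src e) - φ (G.tgt e)) ^ 2

theorem conductance_nonneg (x y : V) : 0 ≤ G.conductance x y :=
  Finset.sum_nonneg fun e _ => (G.c_pos e).le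

theorem deg_nonneg (x : V) : 0 ≤ G.deg x :=
  Finset.sum_nonneg fun e _ => (G.c_pos e).le

variable {G} in
theorem Joins.deg_pos {e : E} {x y : V} (h : G.Joins e x y) : 0 < G.deg x := by
  classical
  exact Finset.sum_pos (fun e _ => G.c_pos e)
    ⟨e, Finset.mem_filter.2 ⟨Finset.mem_univ e, h.imp And.left And.right⟩⟩

theorem stepProb_nonneg (x : V) (e : E) (y : V) : 0 ≤ G.stepProb x e y := by
  unfold stepProb
  split_ifs
  exacts [div_nonneg (G.c_pos e).le (G.deg_nonneg x), le_rfl]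

theorem dirichlet_nonneg (φ : V → ℝ) : 0 ≤ G.dirichlet φ :=
  Finset.sum_nonneg fun e _ => mul_nonneg (G.c_pos e).le (sq_nonneg _)

theorem continuous_dirichlet : Continuous G.dirichlet := by
  unfold dirichlet
  fun_prop

variable {G} in
theorem IsUnitFlow.sum_mul_sub [Finite V] {s t : V} {g : E → ℝ} (hg : G.IsUnitFlow s t g)
    (φ : V → ℝ) : ∑ e, g e * (φ (G.src e) - φ (G.tgt e)) = φ s - φ t := by
  classical
  have := Fintype.ofFinite V
  have hdiv : ∑ x, φ x * ((∑ e with G.src e = x, g e) - ∑ e with G.tgt e = x, g e)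
      = φ s - φ t := by
    simp_rw [hg _]
    simp [mul_sub, Finset.sum_sub_distrib]
  rw [← hdiv]
  simp_rw [Finset.sum_filter, ← Finset.sum_sub_distrib, Finset.mul_sum]
  rw [Finset.sum_comm]
  exact Finset.sum_congr rfl fun e _ => by simp [mul_sub, Finset.sum_sub_distrib, mul_comm]

variable {G} in
theorem IsUnitFlow.sq_sub_le_energy_mul_dirichlet [Finite V] {s t : V} {g : E → ℝ}
    (hg : G.IsUnitFlow s t g) (φ : V → ℝ) :
    (φ s - φ t) ^ 2 ≤ G.energy g * G.dirichlet φ := by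
  rw [← hg.sum_mul_sub φ]
  refine Finset.sum_sq_le_sum_mul_sum_of_sq_le_mul _
    (fun e _ => div_nonneg (sq_nonneg _) (G.c_pos e).le)
    (fun e _ => mul_nonneg (G.c_pos e).le (sq_nonneg _)) fun e _ => le_of_eq ?_
  have := (G.c_pos e).ne'
  field_simp

theorem inv_dirichlet_le_reff [Finite V] {s t : V} {φ : V → ℝ} (hφ : φ s - φ t = 1) :
    (ENNReal.ofReal (G.dirichlet φ))⁻¹ ≤ G.reff s t := by
  refine le_iInf₂ fun g hg => ?_
  have h := hg.sq_sub_le_energy_mul_dirichlet φ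
  rw [hφ, one_pow, mul_comm] at h
  rw [ENNReal.inv_le_iff_le_mul (by simp) (by simp), ← ENNReal.ofReal_mul (G.dirichlet_nonneg φ)]
  exact ENNReal.one_le_ofReal.2 h

variable [Fintype V]

/-- The Laplacian of a potential: `G.laplacian φ x` is the net current out of `x`. -/
noncomputable def laplacian (φ : V → ℝ) (x : V) : ℝ :=
  ∑ y, G.conductance x y * (φ x - φ y)

/-- The Markov operator of the random walk: `G.stepMean ψ x` is the expectation of `ψ` after one
step from `x`. It vanishes at isolated vertices, where no step is possible. -/
noncomputable def stepMean : (V → ℝ) →ₗ[ℝ] V → ℝ where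
  toFun ψ x := ∑ e, ∑ y, G.stepProb x e y * ψ y
  map_add' ψ χ := by
    ext x
    simp only [Pi.add_apply, mul_add, Finset.sum_add_distrib]
  map_smul' r ψ := by
    ext x
    simp only [Pi.smul_apply, smul_eq_mul, RingHom.id_apply, Finset.mul_sum, mul_left_comm r]

theorem stepMean_apply (ψ : V → ℝ) (x : V) :
    G.stepMean ψ x = ∑ e, ∑ y, G.stepProb x e y * ψ y :=
  rfl

theorem sum_conductance (x : V) : ∑ y, G.conductance x y = G.deg x := by
  classical
  simp only [conductance, deg, Finset.sum_filter]
  rw [Finset.sum_comm]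
  refine Finset.sum_congr rfl fun e _ => ?_
  by_cases hs : G.src e = x
  · have hj (y : V) : G.Joins e x y ↔ G.tgt e = y := by grind [Joins]
    simp [hj, hs]
  · have hj (y : V) : G.Joins e x y ↔ G.src e = y ∧ G.tgt e = x := by grind [Joins]
    simp [hj, hs, ite_and]

theorem stepMean_eq_div (ψ : V → ℝ) (x : V) :
    G.stepMean ψ x = (∑ y, G.conductance x y * ψ y) / G.deg x := by
  classical
  simp only [stepMean_apply, conductance, stepProb]
  rw [Finset.sum_comm, Finset.sum_div]
  refine Finset.sum_congr rfl fun y _ => ?_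
  rw [← Finset.sum_mul, mul_div_right_comm, Finset.sum_div, Finset.sum_filter]

theorem laplacian_eq_deg_mul_sub (φ : V → ℝ) (x : V) :
    G.laplacian φ x = G.deg x * (φ x - G.stepMean φ x) := by
  have hdeg : G.deg x = 0 → ∑ y, G.conductance x y * φ y = 0 := by
    intro h
    rw [← sum_conductance, Finset.sum_eq_zero_iff_of_nonneg
      fun y _ => G.conductance_nonneg x y] at h
    exact Finset.sum_eq_zero fun y hy => by rw [h y hy, zero_mul]
  rw [stepMean_eq_div, mul_sub, mul_div_cancel_of_imp' hdeg, ← sum_conductance, Finset.sum_mul,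
    ← Finset.sum_sub_distrib]
  exact Finset.sum_congr rfl fun y _ => mul_sub ..

theorem stepMean_le_of_laplacian_nonneg {φ : V → ℝ} {x : V} (hφ : 0 ≤ φ x)
    (h : 0 ≤ G.laplacian φ x) : G.stepMean φ x ≤ φ x := by
  rw [stepMean_eq_div]
  refine div_le_of_le_mul₀ (G.deg_nonneg x) hφ ?_
  simpa only [laplacian, mul_sub, Finset.sum_sub_distrib, ← Finset.sum_mul, sum_conductance,
    sub_nonneg, mul_comm (G.deg x)] using h

theorem laplacian_nonneg_of_forall_le {φ : V → ℝ} {x : V} (h : ∀ y, φ y ≤ φ x) :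
    0 ≤ G.laplacian φ x :=
  Finset.sum_nonneg fun y _ => mul_nonneg (G.conductance_nonneg x y) (sub_nonneg.2 (h y))

theorem sum_mul_laplacian (φ ψ : V → ℝ) :
    ∑ x, ψ x * G.laplacian φ x
      = ∑ e, G.c e * (φ (G.src e) - φ (G.tgt e)) * (ψ (G.src e) - ψ (G.tgt e)) := by
  classical
  have hjoins (e : E) (x y : V) :
      (if G.Joins e x y then G.c e * (ψ x * (φ x - φ y)) else 0)
        = (if G.src e = x then if G.tgt e = y then G.c e * (ψ x * (φ x - φ y)) else 0 else 0)
          + if G.tgt e = x then if G.src e = y then G.c e * (ψ x * (φ x - φ y)) else 0 else 0 := by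
    grind [Joins]
  calc ∑ x, ψ x * G.laplacian φ x
      = ∑ x, ∑ y, ∑ e, if G.Joins e x y then G.c e * (ψ x * (φ x - φ y)) else 0 := by
        simp only [laplacian, conductance, Finset.mul_sum, Finset.sum_mul, Finset.sum_filter,
          mul_ite, ite_mul, mul_zero, zero_mul, mul_left_comm (ψ _)]
    _ = ∑ e, ∑ x, ∑ y, if G.Joins e x y then G.c e * (ψ x * (φ x - φ y)) else 0 := by
        simp_rw [Finset.sum_comm (s := Finset.univ (α := V)) (t := Finset.univ (α := E))]
    _ = ∑ e, G.c e * (φ (G.src e) - φ (G.tgt e)) * (ψ (G.src e) - ψ (G.tgt e)) := by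
        refine Finset.sum_congr rfl fun e _ => ?_
        simp only [hjoins, Finset.sum_add_distrib, Finset.sum_ite_eq, Finset.mem_univ, if_true,
          Finset.sum_ite_irrel, Finset.sum_const_zero]
        ring

theorem sum_mul_laplacian_self (φ : V → ℝ) : ∑ x, φ x * G.laplacian φ x = G.dirichlet φ := by
  rw [sum_mul_laplacian, dirichlet]
  exact Finset.sum_congr rfl fun e _ => by ring

theorem dirichlet_add_smul (φ ψ : V → ℝ) (r : ℝ) :
    G.dirichlet (φ + r • ψ)
      = G.dirichlet φ + 2 * r * ∑ x, ψ x * G.laplacian φ x + r ^ 2 * G.dirichlet ψ := by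
  rw [sum_mul_laplacian]
  simp only [dirichlet, Finset.mul_sum, ← Finset.sum_add_distrib, Pi.add_apply, Pi.smul_apply,
    smul_eq_mul]
  exact Finset.sum_congr rfl fun e _ => by ring

variable {G} in
theorem sum_sub_mul_laplacian_nonneg_of_isMinOn {K : Set (V → ℝ)} (hK : Convex ℝ K)
    {φ ψ : V → ℝ} (hmin : IsMinOn G.dirichlet K φ) (hφ : φ ∈ K) (hψ : ψ ∈ K) :
    0 ≤ ∑ x, (ψ x - φ x) * G.laplacian φ x := by
  set a := ∑ x, (ψ x - φ x) * G.laplacian φ x with ha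
  have hsecant : ∀ r ∈ Set.Ioc (0 : ℝ) 1, 0 ≤ 2 * a + r * G.dirichlet (ψ - φ) := by
    rintro r ⟨hr0, hr1⟩
    have h := isMinOn_iff.1 hmin _ (hK.add_smul_sub_mem hφ hψ ⟨hr0.le, hr1⟩)
    simp only [dirichlet_add_smul, Pi.sub_apply, ← ha] at h
    refine nonneg_of_mul_nonneg_right (a := r) ?_ hr0
    linarith
  have hlim : Filter.Tendsto (fun r : ℝ => 2 * a + r * G.dirichlet (ψ - φ))
      (nhdsWithin 0 (Set.Ioi 0)) (nhds (2 * a + 0 * G.dirichlet (ψ - φ))) :=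
    (Continuous.tendsto (by fun_prop) 0).mono_left nhdsWithin_le_nhds
  have := ge_of_tendsto hlim (Filter.mem_of_superset (Ioc_mem_nhdsGT one_pos) hsecant)
  linarith

/-- `φ` is the voltage of a unit battery with poles `u` and `s`, to the extent needed here: it
decreases from `1` to `0`, current leaves the network only at `s`, and the current out of `u` is at
least `1 / R`, where `R` stands for an upper bound on the effective resistance. -/
structure IsVoltage (u s : V) (R : ℝ) (φ : V → ℝ) : Prop where
  mem_Icc : φ ∈ Set.Icc 0 1
  source : φ u = 1
  sink : φ s = 0
  laplacian_nonneg : ∀ x ≠ s, 0 ≤ G.laplacian φ x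
  one_le_mul_laplacian : 1 ≤ R * G.laplacian φ u

theorem exists_isVoltage {u s : V} (hsu : s ≠ u) {R : ℝ} (hR : 0 ≤ R)
    (h : G.reff u s ≤ ENNReal.ofReal R) : ∃ φ, G.IsVoltage u s R φ := by
  classical
  have hsingle := single_mem_unitPotentials hsu
  obtain ⟨φ, hφ, hmin⟩ := (isCompact_unitPotentials u s).exists_isMinOn ⟨_, hsingle⟩
    G.continuous_dirichlet.continuousOn
  have hvar {ψ : V → ℝ} (hψ : ψ ∈ unitPotentials u s) :
      0 ≤ ∑ x, (ψ x - φ x) * G.laplacian φ x :=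
    sum_sub_mul_laplacian_nonneg_of_isMinOn (convex_unitPotentials u s) hmin hφ hψ
  have ⟨hφ01, hφu, hφs⟩ := hφ
  refine ⟨φ, hφ01, hφu, hφs, fun x hxs => ?_, ?_⟩
  · rcases (hφ01.2 x).lt_or_eq with hlt | heq
    · have hraise := hvar (update_one_mem_unitPotentials hφ hxs)
      rw [Finset.sum_eq_single x (fun y _ hy => by simp [hy]) (by simp),
        Function.update_self] at hraise
      exact nonneg_of_mul_nonneg_right hraise (sub_pos.2 hlt)
    · exact G.laplacian_nonneg_of_forall_le fun y => (hφ01.2 y).trans heq.ge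
  · have hcurrent : G.dirichlet φ ≤ G.laplacian φ u := by
      simpa [sub_mul, Finset.sum_sub_distrib, sum_mul_laplacian_self, Pi.single_apply]
        using hvar hsingle
    have hreff := (G.inv_dirichlet_le_reff (φ := φ) (by rw [hφu, hφs, sub_zero])).trans h
    rw [ENNReal.inv_le_iff_le_mul (by simp) (by simp), mul_comm, ← ENNReal.ofReal_mul hR,
      ENNReal.one_le_ofReal] at hreff
    exact hreff.trans (mul_le_mul_of_nonneg_left hcurrent hR)

end PotentialTheory

section Walk

variable {V E : Type*} [Fintype V] [Fintype E] (G : WeightedGraph V E)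

theorem stepMean_mono {ψ χ : V → ℝ} (h : ψ ≤ χ) (x : V) : G.stepMean ψ x ≤ G.stepMean χ x :=
  Finset.sum_le_sum fun e _ => Finset.sum_le_sum fun y _ =>
    mul_le_mul_of_nonneg_left (h y) (G.stepProb_nonneg x e y)

theorem stepMean_one_le (x : V) : G.stepMean 1 x ≤ 1 := by
  simpa [stepMean_eq_div, sum_conductance] using div_self_le_one (G.deg x)

theorem stepMean_log_one_add_le {ψ : V → ℝ} (hψ : 0 ≤ ψ) (x : V) :
    G.stepMean (fun y => Real.log (1 + ψ y)) x
      ≤ Real.log (1 + ψ x) - (ψ x - G.stepMean ψ x) / (1 + ψ x) := by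
  have hpos (y : V) : 0 < 1 + ψ y := add_pos_of_pos_of_nonneg one_pos (hψ y)
  set r := Real.log (1 + ψ x) - ψ x / (1 + ψ x) with hr
  have hr0 : 0 ≤ r := by
    have := Real.one_sub_inv_le_log_of_pos (hpos x)
    rw [hr, sub_nonneg]
    convert this using 1
    field_simp [(hpos x).ne']
    ring
  have htangent : (fun y => Real.log (1 + ψ y)) ≤ r • 1 + (1 + ψ x)⁻¹ • ψ := fun y => by
    have := Real.log_le_sub_one_of_pos (div_pos (hpos y) (hpos x))
    rw [Real.log_div (hpos y).ne' (hpos x).ne'] at this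
    have hsplit : (1 + ψ y) / (1 + ψ x) - 1 = (1 + ψ x)⁻¹ * ψ y - ψ x / (1 + ψ x) := by
      field_simp [(hpos x).ne']
      ring
    simp only [Pi.add_apply, Pi.smul_apply, Pi.one_apply, smul_eq_mul, hr]
    linarith
  calc G.stepMean (fun y => Real.log (1 + ψ y)) x
      ≤ G.stepMean (r • 1 + (1 + ψ x)⁻¹ • ψ) x := G.stepMean_mono htangent x
    _ = r * G.stepMean 1 x + (1 + ψ x)⁻¹ * G.stepMean ψ x := by
        simp only [map_add, map_smul, Pi.add_apply, Pi.smul_apply, smul_eq_mul]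
    _ ≤ r * 1 + (1 + ψ x)⁻¹ * G.stepMean ψ x := by
        gcongr
        exact G.stepMean_one_le x
    _ = Real.log (1 + ψ x) - (ψ x - G.stepMean ψ x) / (1 + ψ x) := by
        rw [hr]
        ring

end Walk

section LogPotential

variable {V E : Type*} {u : V} {R : ℝ} {φ : V → V → ℝ} {a : Finset V}

/-- The potential function of the argument: `φ s` is the voltage attached to the target `s`, and
`a` is the set of targets that are still to be visited. -/
noncomputable def logPotential (φ : V → V → ℝ) (a : Finset V) (x : V) : ℝ :=
  Real.log (1 + ∑ s ∈ a, φ s x)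

theorem logPotential_nonneg (hφ : ∀ s ∈ a, 0 ≤ φ s) (x : V) : 0 ≤ logPotential φ a x :=
  Real.log_nonneg (le_add_of_nonneg_right (Finset.sum_nonneg fun s hs => hφ s hs x))

theorem logPotential_le_log_card [Fintype V] (hφ : ∀ s ∈ a, φ s ∈ Set.Icc 0 1) {x : V}
    (hx : x ∉ a) : logPotential φ a x ≤ Real.log (Fintype.card V) := by
  classical
  have hsum0 : 0 ≤ ∑ s ∈ a, φ s x := Finset.sum_nonneg fun s hs => (hφ s hs).1 x
  have hsum : ∑ s ∈ a, φ s x ≤ a.card := by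
    simpa using Finset.sum_le_card_nsmul a (φ · x) 1 fun s hs => (hφ s hs).2 x
  have hcard : a.card + 1 ≤ Fintype.card V := by
    rw [← Finset.card_insert_of_notMem hx]
    exact Finset.card_le_univ _
  refine Real.log_le_log (by positivity) ?_
  have : (a.card : ℝ) + 1 ≤ Fintype.card V := mod_cast hcard
  linarith

theorem logPotential_erase [DecidableEq V] (hφ : ∀ s ∈ a, φ s s = 0) (x : V) :
    logPotential φ (a.erase x) x = logPotential φ a x := by
  unfold logPotential
  by_cases hx : x ∈ a
  · rw [Finset.sum_erase a (f := (φ · x)) (hφ x hx)]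
  · rw [Finset.erase_eq_of_notMem hx]

variable [Fintype V] [Fintype E] {G : WeightedGraph V E}

theorem stepMean_logPotential_le (hφ : ∀ s ∈ a, G.IsVoltage u s R (φ s)) (x : V) :
    G.stepMean (logPotential φ a) x
      ≤ logPotential φ a x
        - (∑ s ∈ a, (φ s x - G.stepMean (φ s) x)) / (1 + ∑ s ∈ a, φ s x) := by
  have h := G.stepMean_log_one_add_le (ψ := ∑ s ∈ a, φ s)
    (Finset.sum_nonneg fun s hs => (hφ s hs).mem_Icc.1) x
  simp only [map_sum, Finset.sum_apply, ← Finset.sum_sub_distrib] at h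
  exact h

theorem stepMean_logPotential_le_self (hφ : ∀ s ∈ a, G.IsVoltage u s R (φ s)) {x : V}
    (hx : x ∉ a) : G.stepMean (logPotential φ a) x ≤ logPotential φ a x := by
  have hφ0 {s : V} (hs : s ∈ a) : 0 ≤ φ s x := (hφ s hs).mem_Icc.1 x
  refine (stepMean_logPotential_le hφ x).trans (sub_le_self _ (div_nonneg ?_ ?_))
  · exact Finset.sum_nonneg fun s hs => sub_nonneg.2 <| G.stepMean_le_of_laplacian_nonneg (hφ0 hs)
      ((hφ s hs).laplacian_nonneg x (ne_of_mem_of_not_mem hs hx).symm)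
  · exact add_nonneg zero_le_one (Finset.sum_nonneg fun s hs => hφ0 hs)

theorem one_le_two_mul_logPotential_sub_stepMean (hR : 0 ≤ R)
    (hφ : ∀ s ∈ a, G.IsVoltage u s R (φ s)) (ha : a.Nonempty) :
    1 ≤ 2 * (R * G.deg u) * (logPotential φ a u - G.stepMean (logPotential φ a) u) := by
  have hκ : 0 ≤ R * G.deg u := mul_nonneg hR (G.deg_nonneg u)
  have hk : (1 : ℝ) ≤ a.card := mod_cast ha.card_pos
  have hpotential : ∑ s ∈ a, φ s u = a.card := by
    simp [Finset.sum_congr rfl fun s hs => (hφ s hs).source]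
  have hdrift : (a.card : ℝ) ≤ R * G.deg u * ∑ s ∈ a, (φ s u - G.stepMean (φ s) u) := by
    rw [Finset.mul_sum, Finset.card_eq_sum_ones, Nat.cast_sum]
    refine Finset.sum_le_sum fun s hs => ?_
    rw [mul_assoc, ← laplacian_eq_deg_mul_sub, Nat.cast_one]
    exact (hφ s hs).one_le_mul_laplacian
  have hstep := stepMean_logPotential_le hφ u
  rw [hpotential, le_sub_comm] at hstep
  calc (1 : ℝ) ≤ 2 * (a.card / (1 + a.card)) := by
        rw [mul_div_assoc', one_le_div (by positivity)]
        linarith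
    _ ≤ 2 * (R * G.deg u * (∑ s ∈ a, (φ s u - G.stepMean (φ s) u)) / (1 + a.card)) := by
        gcongr
    _ ≤ 2 * (R * G.deg u * (logPotential φ a u - G.stepMean (logPotential φ a) u)) := by
        rw [mul_div_assoc]
        gcongr
    _ = _ := (mul_assoc ..).symm

end LogPotential

section Path

variable {V E : Type*}

/-- The vertices visited up to time `t`. -/
def path (x : ℕ → V) (t : ℕ) : Fin (t + 1) → V :=
  fun i => x i

/-- The vertices visited up to time `t` and the edges traversed before time `t`: the past of the
walk at time `t`. -/
def history (x : ℕ → V) (e : ℕ → E) (t : ℕ) : (Fin (t + 1) → V) × (Fin t → E) :=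
  (path x t, fun i => e i)

/-- The past at time `t` together with the edge traversed next and the vertex that it leads to. -/
def transition (x : ℕ → V) (e : ℕ → E) (t : ℕ) :
    ((Fin (t + 1) → V) × (Fin t → E)) × E × V :=
  (history x e t, e t, x (t + 1))

open Classical in
/-- The vertices of `A` that do not occur in the path `p`. -/
noncomputable def unvisited {n : ℕ} (A : Finset V) (p : Fin n → V) : Finset V :=
  {s ∈ A | ∀ i, p i ≠ s}

theorem history_eq_iff {x x' : ℕ → V} {e e' : ℕ → E} {t : ℕ} :
    history x e t = history x' e' t ↔ (∀ i ≤ t, x i = x' i) ∧ ∀ i < t, e i = e' i := by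
  simp only [history, path, Prod.mk.injEq, funext_iff, Fin.forall_iff, Nat.lt_succ_iff]

theorem transition_eq_iff {x x' : ℕ → V} {e e' : ℕ → E} {t : ℕ} :
    transition x e t = transition x' e' t ↔
      (∀ i ≤ t + 1, x i = x' i) ∧ ∀ i ≤ t, e i = e' i := by
  simp only [transition, Prod.mk.injEq, history_eq_iff]
  grind

theorem exists_transition_eq (t : ℕ) (z : ((Fin (t + 1) → V) × (Fin t → E)) × E × V) :
    ∃ x e, transition x e t = z := by
  obtain ⟨⟨p, q⟩, e, y⟩ := z
  refine ⟨fun i => if hi : i < t + 1 then p ⟨i, hi⟩ else y,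
    fun i => if hi : i < t then q ⟨i, hi⟩ else e, ?_⟩
  exact Prod.ext (Prod.ext (funext fun i => dif_pos i.2) (funext fun i => dif_pos i.2))
    (Prod.ext (dif_neg (lt_irrefl t)) (dif_neg (lt_irrefl (t + 1))))

theorem mem_unvisited {n : ℕ} {A : Finset V} {p : Fin n → V} {s : V} :
    s ∈ unvisited A p ↔ s ∈ A ∧ ∀ i, p i ≠ s := by
  simp [unvisited]

theorem unvisited_subset {n : ℕ} (A : Finset V) (p : Fin n → V) : unvisited A p ⊆ A :=
  fun _ hs => (mem_unvisited.1 hs).1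

theorem notMem_unvisited {n : ℕ} (A : Finset V) (p : Fin n → V) (i : Fin n) :
    p i ∉ unvisited A p :=
  fun h => (mem_unvisited.1 h).2 i rfl

theorem unvisited_path_succ [DecidableEq V] (A : Finset V) (x : ℕ → V) (t : ℕ) :
    unvisited A (path x (t + 1)) = (unvisited A (path x t)).erase (x (t + 1)) := by
  ext s
  simp only [mem_unvisited, path, Finset.mem_erase, Fin.forall_fin_succ',
    Fin.val_castSucc, Fin.val_last, ne_comm (a := s)]
  tauto

end Path

namespace IsRandomWalk

variable {V E : Type*} [Fintype E] {Ω : Type*} [MeasurableSpace Ω] {G : WeightedGraph V E}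
  {P : Measure Ω} {x₀ : V} {X : ℕ → Ω → V} {Y : ℕ → Ω → E}

theorem measurableSet_transition_fiber (hW : G.IsRandomWalk P x₀ X Y) (t : ℕ)
    (z : ((Fin (t + 1) → V) × (Fin t → E)) × E × V) :
    MeasurableSet ((fun ω => transition (X · ω) (Y · ω) t) ⁻¹' {z}) := by
  obtain ⟨x, e, rfl⟩ := exists_transition_eq t z
  simp only [Set.preimage, Set.mem_singleton_iff, transition_eq_iff, Set.ofPred_and,
    Set.ofPred_forall]
  exact (MeasurableSet.iInter fun i => .iInter fun _ => hW.measurableSet_vertex i _).inter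
    (MeasurableSet.iInter fun i => .iInter fun _ => hW.measurableSet_edge i _)

theorem measureReal_transition_fiber (hW : G.IsRandomWalk P x₀ X Y) (t : ℕ)
    (z : ((Fin (t + 1) → V) × (Fin t → E)) × E × V) :
    P.real ((fun ω => transition (X · ω) (Y · ω) t) ⁻¹' {z})
      = P.real ((fun ω => history (X · ω) (Y · ω) t) ⁻¹' {z.1})
        * G.stepProb (z.1.1 (Fin.last t)) z.2.1 z.2.2 := by
  obtain ⟨x, e, rfl⟩ := exists_transition_eq t z
  have hstep := congrArg ENNReal.toReal (hW.step t x e)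
  rw [ENNReal.toReal_mul, ENNReal.toReal_ofReal (G.stepProb_nonneg _ _ _)] at hstep
  simp only [← transition_eq_iff, ← history_eq_iff] at hstep
  exact hstep

section Finite

variable [Finite V]

theorem measurableSet_preimage_transition (hW : G.IsRandomWalk P x₀ X Y) (t : ℕ)
    (s : Set (((Fin (t + 1) → V) × (Fin t → E)) × E × V)) :
    MeasurableSet {ω | transition (X · ω) (Y · ω) t ∈ s} :=
  measurableSet_preimage_of_fiber (hW.measurableSet_transition_fiber t) s

theorem integrable_comp_transition (hW : G.IsRandomWalk P x₀ X Y) (t : ℕ)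
    (F : ((Fin (t + 1) → V) × (Fin t → E)) × E × V → ℝ) :
    Integrable (fun ω => F (transition (X · ω) (Y · ω) t)) P :=
  have := hW.isProbabilityMeasure
  integrable_comp_of_fiber (hW.measurableSet_transition_fiber t) F

theorem measurableSet_preimage_history (hW : G.IsRandomWalk P x₀ X Y) (t : ℕ)
    (s : Set ((Fin (t + 1) → V) × (Fin t → E))) :
    MeasurableSet {ω | history (X · ω) (Y · ω) t ∈ s} :=
  hW.measurableSet_preimage_transition t (Prod.fst ⁻¹' s)

theorem integrable_comp_history (hW : G.IsRandomWalk P x₀ X Y) (t : ℕ)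
    (F : (Fin (t + 1) → V) × (Fin t → E) → ℝ) :
    Integrable (fun ω => F (history (X · ω) (Y · ω) t)) P :=
  hW.integrable_comp_transition t (F ∘ Prod.fst)

end Finite

theorem integral_comp_transition [Fintype V] (hW : G.IsRandomWalk P x₀ X Y) (t : ℕ)
    (F : (Fin (t + 1) → V) × (Fin t → E) → E → V → ℝ) :
    ∫ ω, F (history (X · ω) (Y · ω) t) (Y t ω) (X (t + 1) ω) ∂P
      = ∫ ω, ∑ e, ∑ y, G.stepProb (X t ω) e y * F (history (X · ω) (Y · ω) t) e y ∂P := by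
  have := hW.isProbabilityMeasure
  have hhistory := hW.measurableSet_preimage_history t
  calc ∫ ω, F (history (X · ω) (Y · ω) t) (Y t ω) (X (t + 1) ω) ∂P
      = ∑ z, P.real ((fun ω => transition (X · ω) (Y · ω) t) ⁻¹' {z}) * F z.1 z.2.1 z.2.2 :=
        integral_comp_of_fiber (hW.measurableSet_transition_fiber t) fun z => F z.1 z.2.1 z.2.2
    _ = ∑ h, P.real ((fun ω => history (X · ω) (Y · ω) t) ⁻¹' {h})
          * ∑ e, ∑ y, G.stepProb (h.1 (Fin.last t)) e y * F h e y := by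
        simp_rw [hW.measureReal_transition_fiber, Fintype.sum_prod_type (α₂ := E × V),
          Fintype.sum_prod_type (α₁ := E), mul_assoc, Finset.mul_sum]
    _ = ∫ ω, ∑ e, ∑ y, G.stepProb (X t ω) e y * F (history (X · ω) (Y · ω) t) e y ∂P :=
        (integral_comp_of_fiber (fun h => hhistory {h})
          fun h => ∑ e, ∑ y, G.stepProb (h.1 (Fin.last t)) e y * F h e y).symm

theorem measureReal_inter_step [Finite V] (hW : G.IsRandomWalk P x₀ X Y) (t : ℕ) {x : V}
    {B : Set ((Fin (t + 1) → V) × (Fin t → E))} (hB : ∀ h ∈ B, h.1 (Fin.last t) = x)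
    (e : E) (y : V) :
    P.real {ω | history (X · ω) (Y · ω) t ∈ B ∧ Y t ω = e ∧ X (t + 1) ω = y}
      = P.real {ω | history (X · ω) (Y · ω) t ∈ B} * G.stepProb x e y := by
  classical
  have := Fintype.ofFinite V
  have hstep := hW.integral_comp_transition t
    fun h e' y' => if h ∈ B ∧ e' = e ∧ y' = y then (1 : ℝ) else 0
  have hsum (ω : Ω) : ∑ e', ∑ y', G.stepProb (X t ω) e' y' *
        (if history (X · ω) (Y · ω) t ∈ B ∧ e' = e ∧ y' = y then (1 : ℝ) else 0)
      = {ω | history (X · ω) (Y · ω) t ∈ B}.indicator (fun _ => G.stepProb x e y) ω := by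
    by_cases hω : history (X · ω) (Y · ω) t ∈ B
    · have hx : X t ω = x := hB _ hω
      simp [hω, hx, ite_and]
    · simp [hω]
  simp only [hsum] at hstep
  rw [integral_indicator_const _ (hW.measurableSet_preimage_history t B), smul_eq_mul] at hstep
  have hmeas : MeasurableSet {ω | history (X · ω) (Y · ω) t ∈ B ∧ Y t ω = e ∧ X (t + 1) ω = y} :=
    hW.measurableSet_preimage_transition t {z | z.1 ∈ B ∧ z.2.1 = e ∧ z.2.2 = y}
  rw [← hstep, ← integral_indicator_one hmeas]
  exact integral_congr_ae (.of_forall fun ω => by simp [Set.indicator_apply])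

end IsRandomWalk

section Visits

variable {V E : Type*} {Ω : Type*}

/-- The outcomes in which the walk is at `u` at time `t` with some target in `A` still
unvisited. -/
def visitBeforeCover (X : ℕ → Ω → V) (A : Finset V) (u : V) (t : ℕ) : Set Ω :=
  {ω | X t ω = u ∧ (unvisited A (path (X · ω) t)).Nonempty}

/-- The logarithmic potential of the endpoint of a path, with respect to the targets in `A` that
the path has not visited. -/
noncomputable def coverPotential (φ : V → V → ℝ) (A : Finset V) {t : ℕ}
    (p : Fin (t + 1) → V) : ℝ :=
  logPotential φ (unvisited A p) (p (Fin.last t))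

theorem coverPotential_path_succ {φ : V → V → ℝ} {A : Finset V} (hφ : ∀ s ∈ A, φ s s = 0)
    (x : ℕ → V) (t : ℕ) :
    coverPotential φ A (path x (t + 1)) = logPotential φ (unvisited A (path x t)) (x (t + 1)) := by
  classical
  rw [coverPotential, unvisited_path_succ]
  exact logPotential_erase (fun s hs => hφ s (unvisited_subset A _ hs)) _

variable [Fintype E] {G : WeightedGraph V E} [MeasurableSpace Ω] {P : Measure Ω}
  {x₀ : V} {X : ℕ → Ω → V} {Y : ℕ → Ω → E} {A : Finset V} {u : V} {R : ℝ}

theorem IsRandomWalk.measurableSet_visitBeforeCover [Finite V] (hW : G.IsRandomWalk P x₀ X Y)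
    (A : Finset V) (u : V) (t : ℕ) : MeasurableSet (visitBeforeCover X A u t) :=
  hW.measurableSet_preimage_history t {h | h.1 (Fin.last t) = u ∧ (unvisited A h.1).Nonempty}

theorem IsRandomWalk.integrable_coverPotential [Finite V] (hW : G.IsRandomWalk P x₀ X Y)
    (φ : V → V → ℝ) (A : Finset V) (t : ℕ) :
    Integrable (fun ω => coverPotential φ A (path (X · ω) t)) P :=
  hW.integrable_comp_history t fun h => coverPotential φ A h.1

variable [Fintype V]

theorem IsRandomWalk.integral_coverPotential_succ (hW : G.IsRandomWalk P x₀ X Y)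
    {φ : V → V → ℝ} (hφ : ∀ s ∈ A, φ s s = 0) (t : ℕ) :
    ∫ ω, coverPotential φ A (path (X · ω) (t + 1)) ∂P
      = ∫ ω, G.stepMean (logPotential φ (unvisited A (path (X · ω) t))) (X t ω) ∂P := by
  simp only [coverPotential_path_succ hφ]
  exact hW.integral_comp_transition t fun h _ y => logPotential φ (unvisited A h.1) y

theorem IsRandomWalk.measureReal_visitBeforeCover_le (hW : G.IsRandomWalk P x₀ X Y)
    {φ : V → V → ℝ} (hR : 0 ≤ R) (hφ : ∀ s ∈ A, G.IsVoltage u s R (φ s)) (t : ℕ) :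
    P.real (visitBeforeCover X A u t)
      ≤ 2 * (R * G.deg u) * (∫ ω, coverPotential φ A (path (X · ω) t) ∂P
        - ∫ ω, coverPotential φ A (path (X · ω) (t + 1)) ∂P) := by
  have hκ : 0 ≤ R * G.deg u := mul_nonneg hR (G.deg_nonneg u)
  have hmean : Integrable
      (fun ω => G.stepMean (logPotential φ (unvisited A (path (X · ω) t))) (X t ω)) P :=
    hW.integrable_comp_history t
      fun h => G.stepMean (logPotential φ (unvisited A h.1)) (h.1 (Fin.last t))
  have hmeas := hW.measurableSet_visitBeforeCover A u t
  have := hW.isProbabilityMeasure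
  rw [hW.integral_coverPotential_succ fun s hs => (hφ s hs).sink,
    ← integral_sub (hW.integrable_coverPotential φ A t) hmean, ← integral_const_mul,
    ← integral_indicator_one hmeas]
  refine integral_mono ((integrable_const 1).indicator hmeas)
    (((hW.integrable_coverPotential φ A t).sub hmean).const_mul _) fun ω => ?_
  have hφω : ∀ s ∈ unvisited A (path (X · ω) t), G.IsVoltage u s R (φ s) :=
    fun s hs => hφ s (unvisited_subset A _ hs)
  by_cases hω : ω ∈ visitBeforeCover X A u t
  · rw [Set.indicator_of_mem hω]
    obtain ⟨rfl, hne⟩ := hω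
    exact one_le_two_mul_logPotential_sub_stepMean hR hφω hne
  · rw [Set.indicator_of_notMem hω]
    exact mul_nonneg (mul_nonneg zero_le_two hκ) <| sub_nonneg.2 <|
      stepMean_logPotential_le_self hφω (notMem_unvisited A _ (Fin.last t))

theorem IsRandomWalk.sum_measureReal_visitBeforeCover_le (hW : G.IsRandomWalk P x₀ X Y)
    (hR : 0 ≤ R) (hA : ∀ s ∈ A, s ≠ u ∧ G.reff u s ≤ ENNReal.ofReal R) (T : ℕ) :
    ∑ t ∈ Finset.range T, P.real (visitBeforeCover X A u t)
      ≤ 2 * (R * G.deg u) * Real.log (Fintype.card V) := by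
  have := hW.isProbabilityMeasure
  have hκ : 0 ≤ R * G.deg u := mul_nonneg hR (G.deg_nonneg u)
  choose! φ hφ using fun s hs => G.exists_isVoltage (hA s hs).1 hR (hA s hs).2
  set Φ : ℕ → ℝ := fun t => ∫ ω, coverPotential φ A (path (X · ω) t) ∂P
  have hstart : Φ 0 ≤ Real.log (Fintype.card V) := by
    refine (integral_mono (hW.integrable_coverPotential φ A 0) (integrable_const _) fun ω =>
      logPotential_le_log_card (fun s hs => (hφ s (unvisited_subset A _ hs)).mem_Icc)
        (notMem_unvisited A _ (Fin.last 0))).trans_eq ?_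
    simp
  have hend : 0 ≤ Φ T := integral_nonneg fun ω =>
    logPotential_nonneg (fun s hs => (hφ s (unvisited_subset A _ hs)).mem_Icc.1) _
  calc ∑ t ∈ Finset.range T, P.real (visitBeforeCover X A u t)
      ≤ ∑ t ∈ Finset.range T, 2 * (R * G.deg u) * (Φ t - Φ (t + 1)) :=
        Finset.sum_le_sum fun t _ => hW.measureReal_visitBeforeCover_le hR hφ t
    _ = 2 * (R * G.deg u) * (Φ 0 - Φ T) := by rw [← Finset.mul_sum, Finset.sum_range_sub']
    _ ≤ 2 * (R * G.deg u) * Real.log (Fintype.card V) := by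
        gcongr
        linarith

end Visits

section Traversals

variable {V E : Type*} [Fintype E] {G : WeightedGraph V E} {Ω : Type*}

open Classical in
/-- The vertices of `S` within effective resistance `R` of `u`, except for `u` itself. -/
noncomputable def closeTargets [Fintype V] (G : WeightedGraph V E) (S : Set V) (u : V) (R : ℝ) :
    Finset V :=
  {s | s ∈ S ∧ s ≠ u ∧ G.reff u s ≤ ENNReal.ofReal R}

theorem mem_closeTargets [Fintype V] {S : Set V} {u s : V} {R : ℝ} :
    s ∈ G.closeTargets S u R ↔ s ∈ S ∧ s ≠ u ∧ G.reff u s ≤ ENNReal.ofReal R := by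
  simp [closeTargets]

theorem traversalEvent_eq [Fintype V] (X : ℕ → Ω → V) (Y : ℕ → Ω → E) (f : E) (u v : V)
    (S : Set V) (R : ℝ) (t : ℕ) :
    G.traversalEvent X Y f u v S R t
      = {ω | ω ∈ visitBeforeCover X (G.closeTargets S u R) u t ∧ Y t ω = f ∧ X (t + 1) ω = v} := by
  ext ω
  simp only [traversalEvent, visitBeforeCover, Finset.Nonempty, mem_unvisited, path,
    mem_closeTargets, Fin.forall_iff, Nat.lt_succ_iff, Set.mem_ofPred_eq]
  grind

variable [MeasurableSpace Ω] {P : Measure Ω} {x₀ : V} {X : ℕ → Ω → V} {Y : ℕ → Ω → E}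

theorem IsRandomWalk.measurableSet_traversalEvent [Finite V] (hW : G.IsRandomWalk P x₀ X Y) (f : E)
    (u v : V) (S : Set V) (R : ℝ) (t : ℕ) :
    MeasurableSet (G.traversalEvent X Y f u v S R t) := by
  have := Fintype.ofFinite V
  rw [traversalEvent_eq]
  exact hW.measurableSet_preimage_transition t {z | (z.1.1 (Fin.last t) = u ∧
    (unvisited (G.closeTargets S u R) z.1.1).Nonempty) ∧ z.2.1 = f ∧ z.2.2 = v}

theorem IsRandomWalk.measureReal_traversalEvent [Fintype V] (hW : G.IsRandomWalk P x₀ X Y) (f : E)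
    (u v : V) (S : Set V) (R : ℝ) (t : ℕ) :
    P.real (G.traversalEvent X Y f u v S R t)
      = P.real (visitBeforeCover X (G.closeTargets S u R) u t) * G.stepProb u f v := by
  rw [traversalEvent_eq]
  exact hW.measureReal_inter_step t (B := {h | h.1 (Fin.last t) = u ∧
    (unvisited (G.closeTargets S u R) h.1).Nonempty}) (fun _ h => h.1) f v

theorem IsRandomWalk.lintegral_traversalCount [Finite V] (hW : G.IsRandomWalk P x₀ X Y) (f : E)
    (u v : V) (S : Set V) (R : ℝ) :
    ∫⁻ ω, G.traversalCount X Y f u v S R ω ∂P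
      = ∑' t, P (G.traversalEvent X Y f u v S R t) := by
  classical
  have hmeas := hW.measurableSet_traversalEvent f u v S R
  simp_rw [← fun t => lintegral_indicator_one (μ := P) (hmeas t)]
  rw [← lintegral_tsum fun t => (measurable_one.indicator (hmeas t)).aemeasurable]
  simp only [traversalCount, Set.indicator_apply, Pi.one_apply]

theorem IsRandomWalk.sum_measureReal_traversalEvent_le [Fintype V]
    (hW : G.IsRandomWalk P x₀ X Y) {f : E} {u v : V} (hf : G.Joins f u v) (S : Set V) {R : ℝ}
    (hR : 0 ≤ R) (T : ℕ) :
    ∑ t ∈ Finset.range T, P.real (G.traversalEvent X Y f u v S R t)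
      ≤ 2 * Real.log (Fintype.card V) * (G.c f * R) := by
  calc ∑ t ∈ Finset.range T, P.real (G.traversalEvent X Y f u v S R t)
      = (∑ t ∈ Finset.range T, P.real (visitBeforeCover X (G.closeTargets S u R) u t))
          * G.stepProb u f v := by
        simp_rw [hW.measureReal_traversalEvent, Finset.sum_mul]
    _ ≤ 2 * (R * G.deg u) * Real.log (Fintype.card V) * G.stepProb u f v :=
        mul_le_mul_of_nonneg_right (hW.sum_measureReal_visitBeforeCover_le hR
          (fun _ hs => (mem_closeTargets.1 hs).2) T) (G.stepProb_nonneg u f v)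
    _ = 2 * Real.log (Fintype.card V) * (G.c f * R) := by
        rw [stepProb, if_pos hf]
        field_simp [hf.deg_pos.ne']

end Traversals

end WeightedGraph

theorem mainTheorem6 :
    ∃ C : ℝ, 0 < C ∧
      ∀ {V : Type*} {E : Type*} {Ω : Type*} [Fintype V] [Fintype E] [MeasurableSpace Ω]
        (G : WeightedGraph V E) (P : Measure Ω) (x₀ : V) (X : ℕ → Ω → V) (Y : ℕ → Ω → E),
        G.IsRandomWalk P x₀ X Y →
        ∀ (f : E) (u v : V), G.Joins f u v →
        ∀ (S : Set V) (R : ℝ), 0 ≤ R →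
          ∫⁻ ω, G.traversalCount X Y f u v S R ω ∂P
            ≤ ENNReal.ofReal (C * Real.log (Fintype.card V) * (G.c f * R)) := by
  refine ⟨2, two_pos, fun G P x₀ X Y hW f u v hf S R hR => ?_⟩
  have := hW.isProbabilityMeasure
  rw [hW.lintegral_traversalCount]
  refine ENNReal.tsum_le_of_sum_range_le fun T => ?_
  simp_rw [← fun t => ofReal_measureReal (μ := P) (s := G.traversalEvent X Y f u v S R t)]
  rw [← ENNReal.ofReal_sum_of_nonneg fun _ _ => measureReal_nonneg]
  exact ENNReal.ofReal_le_ofReal (hW.sum_measureReal_traversalEvent_le hf S hR T)
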